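/- **Setting.** Fix a linearly ordered set $\mathrm{PROP}$ of proposition symbols with a set $\mathrm{PROP}_1\subseteq\mathrm{PROP}$ of *distinguished* symbols, and an infinite linearly ordered set $\mathrm{VAR}$ of schema variables. For a finite $\Pi\subseteq\mathrm{PROP}$ let $\Pi_1=\Pi\cap\mathrm{PROP}_1$. *Models.* A Kripke model over $\Pi$ is $M=(W,R,V)$ with $W\neq\emptyset$, $R\subseteq W\times W$, $V:\Pi\to\mathcal P(W)$. The identifier of $w\in W$ is the $|\Pi_1|$-bit string of the truth values at $w$ of the symbols of $\Pi_1$ in increasing order; $M$ is a model with identifiers if distinct nodes have distinct identifiers. The $i$th neighbour of $w$ is the $i$th successor of $w$ in the lexicographic order of identifiers. *Programs.* Schemata are built from $\top$, symbols $p\in\Pi$, schema variables, $\neg$, $\wedge$ and diamonds: the single diamond $\Diamond$ in $\mathrm{MSC}$, the diamonds $\Diamond_1,\Diamond_2,\dots$ in $\mathrm{MPMSC}$. Here $\Diamond\varphi$ says that $\varphi$ holds at some successor, and $\Diamond_i\varphi$ that the $i$th neighbour exists and satisfies $\varphi$. A $\Pi$-program has a finite nonempty set of head predicates $Y\in\mathrm{VAR}$,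 and sets of attention and print predicates among them. Each $Y$ has a terminal clause $Y(0):=\varphi$, where $\varphi$ contains no schema variables, and an iteration clause, whose schema variables are head predicates. In $\mathrm{MSC}$ the iteration clauses have the form $Y:=\chi$; in $\mathrm{MPMSC}$ they have the form $Y:=_{\varphi_1,\dots,\varphi_n}\psi_1;\dots;\psi_n;\chi$ with $n\ge 0$ (the value is that of $\psi_k$ for the first condition $\varphi_k$ that holds, and that of $\chi$ if none holds), and it is required that terminal bodies and the $\varphi_k$ have modal depth $0$ and that the $\psi_k$ and $\chi$ have modal depth at most $1$. The formula $Y^0$ is the terminal body of $Y$, and $Y^{n+1}$ is obtained from the iteration clause of $Y$ by replacing every head predicate $Z$ by $Z^n$. The program outputs $s$ at $w$ in round $n$ if $n$ is the first round in which $Y^n$ is true at $w$ for some attention predicate $Y$, and $s$ is the string of truth values at $w$ of $Y^n$ for the print predicates $Y$ in the order of $\mathrm{VAR}$. The size of a program is the number of occurrences of proposition symbols, head predicates, $\top,\neg,\wedge$ and diamonds. **Theorem.** There is a constant $C\in\mathbb N$ such that the following holds. Let $\Pi$ be a finite set of proposition symbols and $\Lambda$ a $\Pi$-program of $\mathrm{MPMSC}$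 of size $m$ with maximum diamond subindex $I$ ($I=0$ if there is no diamond). Then there is a $\Pi$-program $\Gamma$ of $\mathrm{MSC}$ of size at most $C\,(I+|\Pi_1|+m)$ such that, for every Kripke model $M$ with identifiers which interprets all proposition symbols occurring in $\Lambda$ and $\Gamma$ and whose set of distinguished symbols is exactly $\Pi_1$, and for every node $w$ of $M$: 1. (equivalence) $\Lambda$ and $\Gamma$ produce the same output at $w$, or neither produces any output at $w$; 2. (computation time) if $\Lambda$ outputs at $w$ in round $n$, then $\Gamma$ outputs at $w$ in some round $n'\le 2^{C|\Pi_1|}\cdot n$. -/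

import Mathlib

universe u v w

namespace ModalSubst

/-! ### Syntax -/

/-- Schemata over the proposition symbols `P`, the schema variables `X` and one diamond for each
`d : D`.  With `D = Unit` there is a single plain diamond; with `D = ℕ+` there are the numbered
diamonds `◇₁, ◇₂, …`. -/
inductive Schema (P : Type u) (X : Type v) (D : Type) : Type (max u v)
  | top : Schema P X D
  | prop : P → Schema P X D
  | var : X → Schema P X D
  | neg : Schema P X D → Schema P X D
  | and : Schema P X D → Schema P X D → Schema P X D
  | dia : D → Schema P X D → Schema P X D

/-- Modal formulas: schemata without schema variables. -/
abbrev Formula (P : Type u) (D : Type) : Type u := Schema P Empty D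

namespace Schema

variable {P : Type u} {X : Type v} {D : Type}

/-- `φ ∨ ψ`, as an abbreviation of `¬(¬φ ∧ ¬ψ)`. -/
def or (φ ψ : Schema P X D) : Schema P X D := neg (and (neg φ) (neg ψ))

/-- Simultaneous replacement of every schema variable by a formula. -/
def subst (σ : X → Formula P D) : Schema P X D → Formula P D
  | top => top
  | prop p => prop p
  | var Y => σ Y
  | neg φ => neg (subst σ φ)
  | and φ ψ => and (subst σ φ) (subst σ ψ)
  | dia d φ => dia d (subst σ φ)

/-- The number of occurrences of proposition symbols, schema variables, `⊤`, `¬`, `∧` and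
diamonds. -/
def length : Schema P X D → ℕ
  | top => 1
  | prop _ => 1
  | var _ => 1
  | neg φ => φ.length + 1
  | and φ ψ => φ.length + ψ.length + 1
  | dia _ φ => φ.length + 1

/-- Modal depth: the maximum nesting depth of diamonds. -/
def md : Schema P X D → ℕ
  | top => 0
  | prop _ => 0
  | var _ => 0
  | neg φ => φ.md
  | and φ ψ => max φ.md ψ.md
  | dia _ φ => φ.md + 1

/-- The set of proposition symbols that occur in a schema. -/
def props : Schema P X D → Set P
  | top => ∅
  | prop p => {p}
  | var _ => ∅
  | neg φ => φ.props
  | and φ ψ => φ.props ∪ ψ.props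
  | dia _ φ => φ.props

/-- The maximum subindex of a diamond in a schema (`0` if there is no diamond). -/
def maxIndex : Schema P X ℕ+ → ℕ
  | top => 0
  | prop _ => 0
  | var _ => 0
  | neg φ => φ.maxIndex
  | and φ ψ => max φ.maxIndex ψ.maxIndex
  | dia i φ => max (i : ℕ) φ.maxIndex

end Schema

/-- The right-hand side `:=_{φ₁, …, φₙ} ψ₁; …; ψₙ; χ` of an iteration clause: `branches` is the list
of the pairs (condition `φᵢ`, consequence `ψᵢ`) and `backup` is `χ`.  With no branches this is the
right-hand side `:= χ` of a standard iteration clause. -/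
structure Clause (P : Type u) (X : Type v) (D : Type) where
  branches : List (Schema P X D × Schema P X D)
  backup : Schema P X D

namespace Clause

variable {P : Type u} {X : Type v} {D : Type}

/-- The remaining disjuncts of the iteration formula, `neg` being the conjunction of the negations
of the conditions passed so far. -/
def unfoldAux (neg : Formula P D) :
    List (Formula P D × Formula P D) → Formula P D → Formula P D
  | [], χ => .and neg χ
  | (φ, ψ) :: bs, χ => .or (.and neg (.and φ ψ)) (unfoldAux (.and neg (.neg φ)) bs χ)

/-- The formula
`⋁ₖ ((⋀_{j<k} ¬φⱼ) ∧ φₖ ∧ ψₖ) ∨ ((⋀ⱼ ¬φⱼ) ∧ χ)`, which is just `χ` if there are no conditions. -/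
def unfold : List (Formula P D × Formula P D) → Formula P D → Formula P D
  | [], χ => χ
  | (φ, ψ) :: bs, χ => .or (.and φ ψ) (unfoldAux (.neg φ) bs χ)

/-- The next iteration formula that the clause gives, when the current iteration formulas of the
schema variables are `σ`. -/
def next (σ : X → Formula P D) (c : Clause P X D) : Formula P D :=
  unfold (c.branches.map fun b => (b.1.subst σ, b.2.subst σ)) (c.backup.subst σ)

/-- The number of symbol occurrences in the conditions, the consequences and the backup. -/
def length (c : Clause P X D) : ℕ :=
  (c.branches.map fun b => b.1.length + b.2.length).sum + c.backup.length

/-- The proposition symbols that occur in the clause. -/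
def props (c : Clause P X D) : Set P :=
  {p | (∃ b ∈ c.branches, p ∈ b.1.props ∨ p ∈ b.2.props) ∨ p ∈ c.backup.props}

/-- The maximum subindex of a diamond in the clause (`0` if there is no diamond). -/
def maxIndex (c : Clause P X ℕ+) : ℕ :=
  max ((c.branches.map fun b => max b.1.maxIndex b.2.maxIndex).foldr max 0) c.backup.maxIndex

end Clause

/-- A program with finite nonempty set `heads` of head predicates.  Each head predicate `Y` has the
terminal clause `Y(0) := term Y`, whose body contains no schema variables, and the (possibly
conditional) iteration clause `Y := iter Y`, in which only head predicates occur as schema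
variables. -/
structure Program (P : Type u) (VAR : Type v) (D : Type) where
  heads : Finset VAR
  heads_nonempty : heads.Nonempty
  term : {Y // Y ∈ heads} → Formula P D
  iter : {Y // Y ∈ heads} → Clause P {Y // Y ∈ heads} D
  attention : Finset {Y // Y ∈ heads}
  print : Finset {Y // Y ∈ heads}

namespace Program

variable {P : Type u} {VAR : Type v} {D : Type}

/-- The `n`th iteration formula `Yⁿ` of the head predicate `Y`. -/
def iterFormula (Λ : Program P VAR D) : ℕ → {Y // Y ∈ Λ.heads} → Formula P D
  | 0, Y => Λ.term Y
  | n + 1, Y => (Λ.iter Y).next (Λ.iterFormula n)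

/-- The length (size) of a program: the number of occurrences of proposition symbols, head
predicates (also to the left of `:=`), `⊤`, `¬`, `∧` and diamonds. -/
def length (Λ : Program P VAR D) : ℕ :=
  ∑ Y, ((1 + (Λ.term Y).length) + (1 + (Λ.iter Y).length))

/-- The proposition symbols that occur in a program. -/
def props (Λ : Program P VAR D) : Set P :=
  {p | ∃ Y, p ∈ (Λ.term Y).props ∨ p ∈ (Λ.iter Y).props}

/-- The maximum subindex of a diamond in a program (`0` if there is no diamond). -/
def maxIndex (Λ : Program P VAR ℕ+) : ℕ :=
  Finset.univ.sup fun Y => max (Λ.term Y).maxIndex (Λ.iter Y).maxIndex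

/-- The program is a program of MSC: it has only the plain diamond, and no conditional rules. -/
def IsMSC (Λ : Program P VAR Unit) : Prop :=
  ∀ Y, (Λ.iter Y).branches = []

/-- The program is a program of message passing MSC: it has only numbered diamonds, terminal
clauses and conditions have modal depth `0`, and consequences, backups and bodies of standard
iteration clauses have modal depth at most `1`. -/
def IsMPMSC (Λ : Program P VAR ℕ+) : Prop :=
  ∀ Y, (Λ.term Y).md = 0 ∧
    (∀ b ∈ (Λ.iter Y).branches, b.1.md = 0 ∧ b.2.md ≤ 1) ∧
    (Λ.iter Y).backup.md ≤ 1

/-- The program is a program over the set `S` of proposition symbols. -/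
def IsOver (Λ : Program P VAR D) (S : Finset P) : Prop := Λ.props ⊆ S

end Program

/-! ### Kripke models with identifiers -/

open Classical in
/-- The distinguished proposition symbols in `S`, where `PROP₁` is the set of all distinguished
proposition symbols. -/
noncomputable def distinguished {P : Type u} (PROP₁ : Set P) (S : Finset P) : Finset P :=
  S.filter (· ∈ PROP₁)

/-- Kripke models over the set `S` of proposition symbols. -/
structure KripkeModel {P : Type u} (S : Finset P) where
  W : Type w
  nonempty : Nonempty W
  R : W → W → Prop
  V : {p // p ∈ S} → Set W

namespace KripkeModel

variable {P : Type u} {S : Finset P}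

/-- The symbol `p` is true at `x` (false if the model does not interpret `p`). -/
def Holds (M : KripkeModel.{u, w} S) (x : M.W) (p : P) : Prop :=
  ∃ h : p ∈ S, x ∈ M.V ⟨p, h⟩

open Classical in
/-- The identifier of a node: the string of the truth values of the distinguished symbols, which
are taken in increasing order. -/
noncomputable def ident [LinearOrder P] (M : KripkeModel.{u, w} S) (PROP₁ : Set P) (x : M.W) :
    List Bool :=
  ((distinguished PROP₁ S).sort (· ≤ ·)).map fun p => decide (M.Holds x p)

/-- The model is a model with identifiers: distinct nodes have distinct identifiers. -/
def HasIdentifiers [LinearOrder P] (M : KripkeModel.{u, w} S) (PROP₁ : Set P) : Prop :=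
  Function.Injective (M.ident PROP₁)

/-- The accessibility relation, as interpretation of the plain diamond. -/
def plainAcc (M : KripkeModel.{u, w} S) : Unit → M.W → M.W → Prop :=
  fun _ => M.R

/-- The interpretation of the numbered diamonds: `y` is the `i`th neighbour of `x`, that is, a
successor of `x` such that exactly `i - 1` successors of `x` have a lexicographically smaller
identifier.  (Used only for models with identifiers, which are finite.) -/
def numberedAcc [LinearOrder P] (M : KripkeModel.{u, w} S) (PROP₁ : Set P) :
    ℕ+ → M.W → M.W → Prop :=
  fun i x y => M.R x y ∧
    {z | M.R x z ∧ M.ident PROP₁ z < M.ident PROP₁ y}.ncard + 1 = (i : ℕ)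

/-- Truth of a formula at a node, the diamonds being interpreted by the relations `acc`. -/
def Sat {D : Type} (M : KripkeModel.{u, w} S) (acc : D → M.W → M.W → Prop) :
    M.W → Formula P D → Prop
  | _, .top => True
  | x, .prop p => M.Holds x p
  | x, .neg φ => ¬ Sat M acc x φ
  | x, .and φ ψ => Sat M acc x φ ∧ Sat M acc x ψ
  | x, .dia d φ => ∃ y, acc d x y ∧ Sat M acc y φ

end KripkeModel

/-! ### Acceptance and output -/

/-- A sequence `b` of strings of bits, with positions in `ι`, accepts in round `n` with respect to
the attention positions `A`: some attention bit is `1` in round `n`, and none is in any earlier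
round. -/
def Accepts {ι : Type v} (b : ℕ → ι → Bool) (A : Finset ι) (n : ℕ) : Prop :=
  (∃ i ∈ A, b n i = true) ∧ ∀ m < n, ∀ i ∈ A, b m i = false

namespace Program

variable {P : Type u} {VAR : Type v} {D : Type} {S : Finset P}

open Classical in
/-- The global configurations: in round `n` at the node `x`, the bit of the head predicate `Y` is
`1` iff `Yⁿ` is true at `x`. -/
noncomputable def config (Λ : Program P VAR D) (M : KripkeModel.{u, w} S)
    (acc : D → M.W → M.W → Prop) (x : M.W) (n : ℕ) (Y : {Y // Y ∈ Λ.heads}) : Bool :=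
  decide (M.Sat acc x (Λ.iterFormula n Y))

/-- The node `x` outputs the string `s` in round `n`: it accepts in round `n`, and `s` is the string
of the print bits of round `n`, in the order of the schema variables. -/
def OutputsIn [LinearOrder VAR] (Λ : Program P VAR D) (M : KripkeModel.{u, w} S)
    (acc : D → M.W → M.W → Prop) (x : M.W) (s : List Bool) (n : ℕ) : Prop :=
  Accepts (Λ.config M acc x) Λ.attention n ∧
    s = (Λ.print.sort (· ≤ ·)).map (Λ.config M acc x n)

/-- A model over `S` is suitable for the program if it interprets all proposition symbols that
occur in the program. -/
def Suitable (Λ : Program P VAR D) {S : Finset P} (_M : KripkeModel.{u, w} S) : Prop :=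
  Λ.props ⊆ S

/-- Acceptance equivalence of a program `Λ` with numbered diamonds and a program `Γ` with plain
diamonds, for identifiers over the distinguished symbols of `S`: on every model that has such
identifiers and is suitable for both programs, at every node, both programs have the same output or
both have none. -/
def Equivalent [LinearOrder P] [LinearOrder VAR] (PROP₁ : Set P) (S : Finset P)
    (Λ : Program P VAR ℕ+) (Γ : Program P VAR Unit) : Prop :=
  ∀ (S' : Finset P), distinguished PROP₁ S' = distinguished PROP₁ S →
    ∀ M : KripkeModel.{u, w} S', M.HasIdentifiers PROP₁ → Λ.Suitable M → Γ.Suitable M →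
      ∀ (x : M.W) (s : List Bool),
        (∃ n, Λ.OutputsIn M (M.numberedAcc PROP₁) x s n) ↔ ∃ n, Γ.OutputsIn M M.plainAcc x s n

/-- The computation time of `Γ` is at most `T` times that of `Λ`: on every model as above, if `Λ`
outputs at a node in round `n`, then `Γ` outputs there in a round `n' ≤ T * n`. -/
def TimeAtMost [LinearOrder P] [LinearOrder VAR] (PROP₁ : Set P) (S : Finset P)
    (Λ : Program P VAR ℕ+) (Γ : Program P VAR Unit) (T : ℕ) : Prop :=
  ∀ (S' : Finset P), distinguished PROP₁ S' = distinguished PROP₁ S →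
    ∀ M : KripkeModel.{u, w} S', M.HasIdentifiers PROP₁ → Λ.Suitable M → Γ.Suitable M →
      ∀ (x : M.W) (s : List Bool) (n : ℕ), Λ.OutputsIn M (M.numberedAcc PROP₁) x s n →
        ∃ n' ≤ T * n, Γ.OutputsIn M M.plainAcc x s n'

end Program

end ModalSubst

/-!
The simulating program contains a binary counter of `|Π₁|` bits.  Carries are propagated one
position per step, so bit `i` runs `i` steps late; comparing the counter with the identifier of a
node is pipelined in the same way.  During one period of the counter the nodes therefore become
active one after the other, in the order of their identifiers.  Every node counts its active
successors, and so learns which of them is its `i`th neighbour at the moment when that neighbour is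
active; diamonds are accumulated this way, and the next round is computed when the counter
overflows.
-/

namespace ModalSubst

/-! ### Syntax of schemata and clauses -/

namespace Schema

universe v'

variable {P : Type u} {X : Type v} {X' : Type v'} {D D' : Type}

/-- `if c then φ else ψ`, as an abbreviation of `(c ∧ φ) ∨ (¬c ∧ ψ)`. -/
def ite (c φ ψ : Schema P X D) : Schema P X D := or (and c φ) (and (neg c) ψ)

/-- The translation that renames the variables along `f` and replaces every diamond subschema
`◇_d φ` by `g d φ φ'`, where `φ'` is the translation of `φ`. -/
def translate (f : X → X') (g : D → Schema P X D → Schema P X' D' → Schema P X' D') :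
    Schema P X D → Schema P X' D'
  | top => top
  | prop p => prop p
  | var Y => var (f Y)
  | neg φ => neg (translate f g φ)
  | and φ ψ => and (translate f g φ) (translate f g ψ)
  | dia d φ => g d φ (translate f g φ)

/-- Renaming of the schema variables. -/
def rename (f : X → X') : Schema P X D → Schema P X' D := translate f fun d _ φ => dia d φ

open Classical in
/-- The subschemata of the form `◇_d φ`, each represented by the pair `(d, φ)`. -/
noncomputable def diaSubs : Schema P X D → Finset (D × Schema P X D)
  | top => ∅
  | prop _ => ∅
  | var _ => ∅
  | neg φ => φ.diaSubs
  | and φ ψ => φ.diaSubs ∪ ψ.diaSubs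
  | dia d φ => insert (d, φ) φ.diaSubs

lemma length_pos (φ : Schema P X D) : 0 < φ.length := by
  cases φ <;> simp [length]

lemma length_or (φ ψ : Schema P X D) : (or φ ψ).length = φ.length + ψ.length + 4 := by
  simp only [or, length]; ring

lemma length_ite (c φ ψ : Schema P X D) :
    (ite c φ ψ).length = 2 * c.length + φ.length + ψ.length + 7 := by
  simp only [ite, length, length_or]; ring

lemma props_or (φ ψ : Schema P X D) : (or φ ψ).props = φ.props ∪ ψ.props := rfl

lemma props_ite (c φ ψ : Schema P X D) :
    (ite c φ ψ).props = c.props ∪ φ.props ∪ ψ.props := by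
  ext p; simp only [ite, props_or, props, Set.mem_union]; tauto

lemma md_ite (c φ ψ : Schema P X D) : (ite c φ ψ).md = max c.md (max φ.md ψ.md) := by
  simp only [ite, or, md]; omega

lemma maxIndex_ite (c φ ψ : Schema P X ℕ+) :
    (ite c φ ψ).maxIndex = max c.maxIndex (max φ.maxIndex ψ.maxIndex) := by
  simp only [ite, or, maxIndex]; omega

section Translate

variable {f : X → X'} {g : D → Schema P X D → Schema P X' D' → Schema P X' D'}

lemma length_translate_le {c : ℕ} (hc : 1 ≤ c) (hg : ∀ d φ φ', (g d φ φ').length ≤ φ'.length + c)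
    (φ : Schema P X D) : (φ.translate f g).length ≤ c * φ.length := by
  induction φ with
  | top | prop | var => simpa [translate, length] using hc
  | neg φ ih => simp only [translate, length]; linarith
  | and φ ψ ihφ ihψ => simp only [translate, length]; linarith
  | dia d φ ih => exact (hg d φ _).trans (by simp only [length]; linarith)

lemma props_translate_subset {s : Set P} (hg : ∀ d φ φ', φ'.props ⊆ s → (g d φ φ').props ⊆ s)
    {φ : Schema P X D} (h : φ.props ⊆ s) : (φ.translate f g).props ⊆ s := by
  induction φ with
  | top | prop | var => exact h
  | neg φ ih => exact ih h
  | and φ ψ ihφ ihψ =>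
    exact Set.union_subset (ihφ (Set.union_subset_iff.1 h).1) (ihψ (Set.union_subset_iff.1 h).2)
  | dia d φ ih => exact hg d φ _ (ih h)

lemma length_rename_le (φ : Schema P X D) : (φ.rename f).length ≤ φ.length :=
  (length_translate_le le_rfl (fun _ _ _ => le_rfl) φ).trans_eq (one_mul _)

lemma props_rename_subset (φ : Schema P X D) : (φ.rename f).props ⊆ φ.props :=
  props_translate_subset (g := fun d _ φ => dia d φ) (fun _ _ _ h => h) subset_rfl

end Translate

lemma diaSubs_eq_empty {φ : Schema P X D} (h : φ.md = 0) : φ.diaSubs = ∅ := by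
  induction φ with
  | top | prop | var => rfl
  | neg φ ih => exact ih h
  | and φ ψ ihφ ihψ =>
    rw [md, Nat.max_eq_zero_iff] at h
    simp only [diaSubs, ihφ h.1, ihψ h.2, Finset.empty_union]
  | dia d φ => simp [md] at h

lemma mem_diaSubs_and {φ ψ : Schema P X D} {d : D × Schema P X D} :
    d ∈ (and φ ψ).diaSubs ↔ d ∈ φ.diaSubs ∨ d ∈ ψ.diaSubs := by
  simp only [diaSubs, Finset.mem_union]

lemma mem_diaSubs_dia {i : D} {φ : Schema P X D} {d : D × Schema P X D} :
    d ∈ (dia i φ).diaSubs ↔ d = (i, φ) ∨ d ∈ φ.diaSubs := by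
  simp only [diaSubs, Finset.mem_insert]

lemma le_maxIndex_of_mem_diaSubs {φ : Schema P X ℕ+} {d : ℕ+ × Schema P X ℕ+}
    (hd : d ∈ φ.diaSubs) : (d.1 : ℕ) ≤ φ.maxIndex := by
  induction φ with
  | top | prop | var => simp [diaSubs] at hd
  | neg φ ih => exact ih hd
  | and φ ψ ihφ ihψ =>
    rcases mem_diaSubs_and.1 hd with h | h
    exacts [le_max_of_le_left (ihφ h), le_max_of_le_right (ihψ h)]
  | dia i φ ih =>
    rcases mem_diaSubs_dia.1 hd with rfl | h
    exacts [le_max_left _ _, le_max_of_le_right (ih h)]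

lemma props_subset_of_mem_diaSubs {φ : Schema P X D} {d : D × Schema P X D}
    (hd : d ∈ φ.diaSubs) : d.2.props ⊆ φ.props := by
  induction φ with
  | top | prop | var => simp [diaSubs] at hd
  | neg φ ih => exact ih hd
  | and φ ψ ihφ ihψ =>
    rcases mem_diaSubs_and.1 hd with h | h
    exacts [Set.subset_union_of_subset_left (ihφ h) _, Set.subset_union_of_subset_right (ihψ h) _]
  | dia i φ ih =>
    rcases mem_diaSubs_dia.1 hd with rfl | h
    exacts [subset_rfl, ih h]

lemma md_eq_zero_of_mem_diaSubs {φ : Schema P X D} (h : φ.md ≤ 1) {d : D × Schema P X D}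
    (hd : d ∈ φ.diaSubs) : d.2.md = 0 := by
  induction φ with
  | top | prop | var => simp [diaSubs] at hd
  | neg φ ih => exact ih h hd
  | and φ ψ ihφ ihψ =>
    rw [md, max_le_iff] at h
    exact (mem_diaSubs_and.1 hd).elim (ihφ h.1) (ihψ h.2)
  | dia i φ ih =>
    have hφ : φ.md = 0 := Nat.le_zero.1 (Nat.le_of_succ_le_succ h)
    rw [mem_diaSubs_dia, diaSubs_eq_empty hφ] at hd
    rcases hd with rfl | hd
    exacts [hφ, absurd hd (Finset.notMem_empty d)]

lemma sum_length_diaSubs_le {φ : Schema P X D} (h : φ.md ≤ 1) :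
    ∑ d ∈ φ.diaSubs, (d.2.length + 1) ≤ φ.length := by
  classical
  induction φ with
  | top | prop | var => simp [diaSubs]
  | neg φ ih => exact (ih h).trans (Nat.le_succ _)
  | and φ ψ ihφ ihψ =>
    rw [md, max_le_iff] at h
    calc ∑ d ∈ (and φ ψ).diaSubs, (d.2.length + 1)
        ≤ ∑ d ∈ φ.diaSubs, (d.2.length + 1) + ∑ d ∈ ψ.diaSubs, (d.2.length + 1) :=
          (Nat.le_add_right _ _).trans_eq Finset.sum_union_inter
      _ ≤ φ.length + ψ.length + 1 := by linarith [ihφ h.1, ihψ h.2]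
  | dia d φ => simp [diaSubs, diaSubs_eq_empty (Nat.le_zero.1 (Nat.le_of_succ_le_succ h)), length]

end Schema

namespace Clause

variable {P : Type u} {X : Type v} {D : Type}

/-- The single schema equivalent to the right-hand side of a clause. -/
def toSchema (c : Clause P X D) : Schema P X D :=
  c.branches.foldr (fun b φ => .ite b.1 b.2 φ) c.backup

@[elab_as_elim]
lemma branches_induction {motive : Clause P X D → Prop} (nil : ∀ χ, motive ⟨[], χ⟩)
    (cons : ∀ φ ψ bs χ, motive ⟨bs, χ⟩ → motive ⟨(φ, ψ) :: bs, χ⟩) (c : Clause P X D) :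
    motive c := by
  obtain ⟨bs, χ⟩ := c
  induction bs with
  | nil => exact nil χ
  | cons b bs ih => exact cons b.1 b.2 bs χ ih

lemma length_toSchema_le (c : Clause P X D) : c.toSchema.length ≤ 9 * c.length := by
  induction c using branches_induction with
  | nil χ => simp only [toSchema, length, List.foldr_nil, List.map_nil, List.sum_nil]; omega
  | cons φ ψ bs χ ih =>
    have := φ.length_pos
    simp only [toSchema, length, List.foldr_cons, List.map_cons, List.sum_cons,
      Schema.length_ite] at ih ⊢
    omega

lemma md_toSchema_le {n : ℕ} {c : Clause P X D} (hb : ∀ b ∈ c.branches, b.1.md ≤ n ∧ b.2.md ≤ n)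
    (hχ : c.backup.md ≤ n) : c.toSchema.md ≤ n := by
  induction c using branches_induction with
  | nil χ => exact hχ
  | cons φ ψ bs χ ih =>
    rw [List.forall_mem_cons] at hb
    exact (Schema.md_ite φ ψ _).trans_le (max_le hb.1.1 (max_le hb.1.2 (ih hb.2 hχ)))

lemma props_toSchema (c : Clause P X D) : c.toSchema.props = c.props := by
  induction c using branches_induction with
  | nil χ => ext; simp [toSchema, props]
  | cons φ ψ bs χ ih =>
    ext p
    have := Set.ext_iff.1 ih p
    simp only [toSchema, props, List.foldr_cons, Schema.props_ite, List.mem_cons, or_and_right,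
      exists_or, exists_eq_left, Set.mem_union, Set.mem_ofPred_eq, or_assoc] at this ⊢
    rw [this]

lemma maxIndex_toSchema (c : Clause P X ℕ+) : c.toSchema.maxIndex = c.maxIndex := by
  induction c using branches_induction with
  | nil χ => simp [toSchema, maxIndex]
  | cons φ ψ bs χ ih =>
    simp only [toSchema, maxIndex, List.foldr_cons, List.map_cons, Schema.maxIndex_ite] at ih ⊢
    omega

end Clause

/-! ### Semantics of schemata and clauses -/

namespace KripkeModel

universe v'

variable {P : Type u} {S : Finset P} {X : Type v} {X' : Type v'} {D D' : Type}

/-- Truth of a schema at a node under an interpretation `ν` of the schema variables. -/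
def Eval (M : KripkeModel.{u, w} S) (acc : D → M.W → M.W → Prop) (ν : X → M.W → Prop) :
    Schema P X D → M.W → Prop
  | .top, _ => True
  | .prop p, x => M.Holds x p
  | .var Y, x => ν Y x
  | .neg φ, x => ¬ Eval M acc ν φ x
  | .and φ ψ, x => Eval M acc ν φ x ∧ Eval M acc ν ψ x
  | .dia d φ, x => ∃ y, acc d x y ∧ Eval M acc ν φ y

variable {M : KripkeModel.{u, w} S} {acc : D → M.W → M.W → Prop} {ν : X → M.W → Prop}

lemma eval_or {φ ψ : Schema P X D} {x : M.W} :
    M.Eval acc ν (.or φ ψ) x ↔ M.Eval acc ν φ x ∨ M.Eval acc ν ψ x := by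
  simp only [Schema.or, Eval]; tauto

lemma eval_ite {c φ ψ : Schema P X D} {x : M.W} :
    M.Eval acc ν (.ite c φ ψ) x ↔
      (M.Eval acc ν c x → M.Eval acc ν φ x) ∧ (¬ M.Eval acc ν c x → M.Eval acc ν ψ x) := by
  simp only [Schema.ite, eval_or, Eval]; tauto

lemma sat_subst {σ : X → Formula P D} {φ : Schema P X D} {x : M.W} :
    M.Sat acc x (φ.subst σ) ↔ M.Eval acc (fun Y y => M.Sat acc y (σ Y)) φ x := by
  induction φ generalizing x with
  | top | prop | var => exact Iff.rfl
  | neg φ ih => exact not_congr ih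
  | and φ ψ ihφ ihψ => exact and_congr ihφ ihψ
  | dia d φ ih => exact exists_congr fun y => and_congr_right' ih

lemma sat_iff_eval {φ : Formula P D} {x : M.W} :
    M.Sat acc x φ ↔ M.Eval acc (fun Y _ => Y.elim) φ x := by
  induction φ generalizing x with
  | top | prop => exact Iff.rfl
  | var Y => exact Y.elim
  | neg φ ih => exact not_congr ih
  | and φ ψ ihφ ihψ => exact and_congr ihφ ihψ
  | dia d φ ih => exact exists_congr fun y => and_congr_right' ih

lemma eval_translate {acc' : D' → M.W → M.W → Prop} {ν' : X' → M.W → Prop} {f : X → X'}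
    {g : D → Schema P X D → Schema P X' D' → Schema P X' D'} {φ : Schema P X D} {x : M.W}
    (hf : ∀ Y x, ν' (f Y) x ↔ ν Y x)
    (hg : ∀ d ψ, (d, ψ) ∈ φ.diaSubs →
      (∀ y, M.Eval acc' ν' (ψ.translate f g) y ↔ M.Eval acc ν ψ y) →
        ∀ y, M.Eval acc' ν' (g d ψ (ψ.translate f g)) y ↔ ∃ z, acc d y z ∧ M.Eval acc ν ψ z) :
    M.Eval acc' ν' (φ.translate f g) x ↔ M.Eval acc ν φ x := by
  induction φ generalizing x with
  | top | prop => exact Iff.rfl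
  | var Y => exact hf Y x
  | neg φ ih => exact not_congr (ih hg)
  | and φ ψ ihφ ihψ =>
    exact and_congr (ihφ fun d ψ h => hg d ψ (Schema.mem_diaSubs_and.2 (.inl h)))
      (ihψ fun d ψ h => hg d ψ (Schema.mem_diaSubs_and.2 (.inr h)))
  | dia d φ ih =>
    exact hg d φ (Schema.mem_diaSubs_dia.2 (.inl rfl))
      (fun y => ih fun d ψ h => hg d ψ (Schema.mem_diaSubs_dia.2 (.inr h))) x

lemma eval_rename {ν' : X' → M.W → Prop} {f : X → X'} {φ : Schema P X D} {x : M.W}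
    (hf : ∀ Y x, ν' (f Y) x ↔ ν Y x) : M.Eval acc ν' (φ.rename f) x ↔ M.Eval acc ν φ x :=
  eval_translate hf fun _ _ _ hψ _ => exists_congr fun z => and_congr_right' (hψ z)

lemma eval_congr_of_md_eq_zero {acc' : D → M.W → M.W → Prop} {φ : Schema P X D} {x : M.W}
    (h : φ.md = 0) : M.Eval acc ν φ x ↔ M.Eval acc' ν φ x := by
  induction φ with
  | top | prop | var => exact Iff.rfl
  | neg φ ih => exact not_congr (ih h)
  | and φ ψ ihφ ihψ =>
    rw [Schema.md, Nat.max_eq_zero_iff] at h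
    exact and_congr (ihφ h.1) (ihψ h.2)
  | dia d φ => simp [Schema.md] at h

lemma sat_unfoldAux {σ : X → Formula P D} {η : Formula P D} {c : Clause P X D} {x : M.W} :
    M.Sat acc x (Clause.unfoldAux η (c.branches.map fun b => (b.1.subst σ, b.2.subst σ))
        (c.backup.subst σ)) ↔
      M.Sat acc x η ∧ M.Eval acc (fun Y y => M.Sat acc y (σ Y)) c.toSchema x := by
  induction c using Clause.branches_induction generalizing η with
  | nil χ => exact and_congr_right' sat_subst
  | cons φ ψ bs χ ih =>
    simp only [Clause.toSchema, List.foldr_cons, List.map_cons, Clause.unfoldAux, Schema.or,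
      Sat, sat_subst, eval_ite, ih]
    tauto

lemma sat_next {σ : X → Formula P D} {c : Clause P X D} {x : M.W} :
    M.Sat acc x (c.next σ) ↔ M.Eval acc (fun Y y => M.Sat acc y (σ Y)) c.toSchema x := by
  obtain ⟨_ | ⟨⟨φ, ψ⟩, bs⟩, χ⟩ := c
  · exact sat_subst
  · have := sat_unfoldAux (M := M) (acc := acc) (σ := σ) (η := .neg (φ.subst σ)) (c := ⟨bs, χ⟩)
      (x := x)
    simp only [Clause.next, Clause.toSchema, List.foldr_cons, List.map_cons, Clause.unfold,
      Schema.or, Sat, sat_subst, eval_ite] at this ⊢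
    rw [this]
    tauto

end KripkeModel

/-! ### The binary clock -/

section BinaryCounting

lemma two_pow_succ_dvd_add_one_iff {n i : ℕ} :
    2 ^ (i + 1) ∣ n + 1 ↔ 2 ^ i ∣ n + 1 ∧ n.testBit i = true := by
  by_cases h : 2 ^ i ∣ n + 1
  · obtain ⟨q, hq⟩ := h
    have hdiv : q = n / 2 ^ i + 1 := by
      rw [← Nat.succ_div_of_dvd ⟨q, hq⟩, hq, Nat.mul_div_cancel_left _ (by positivity)]
    rw [hq, pow_succ, Nat.mul_dvd_mul_iff_left (by positivity), Nat.testBit_eq_decide_div_mod_eq,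
      decide_eq_true_iff]
    simp only [dvd_mul_right, true_and]
    omega
  · exact iff_of_false (fun h' => h ((pow_dvd_pow 2 i.le_succ).trans h')) fun h' => h h'.1

lemma testBit_add_one {n i : ℕ} :
    (n + 1).testBit i = if 2 ^ i ∣ n + 1 then !n.testBit i else n.testBit i := by
  simp only [Nat.testBit_eq_decide_div_mod_eq, Nat.succ_div]
  split_ifs
  · rw [← decide_not, decide_eq_decide]
    omega
  · rfl

lemma modEq_two_pow_succ_iff {n m i : ℕ} :
    n ≡ m [MOD 2 ^ (i + 1)] ↔ n ≡ m [MOD 2 ^ i] ∧ n.testBit i = m.testBit i := by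
  refine ⟨fun h => ⟨h.of_dvd (pow_dvd_pow 2 i.le_succ), ?_⟩, fun ⟨hmod, hbit⟩ => ?_⟩
  · have := congrArg (Nat.testBit · i) (show n % _ = m % _ from h)
    simpa only [Nat.testBit_mod_two_pow, i.lt_succ_self, decide_true, Bool.true_and] using this
  · simp only [Nat.testBit_eq_decide_div_mod_eq, decide_eq_decide] at hbit
    have : n / 2 ^ i % 2 = m / 2 ^ i % 2 := by omega
    rw [Nat.ModEq, Nat.mod_pow_succ, Nat.mod_pow_succ, this, hmod]

end BinaryCounting

/-- The number of rounds of the simulated program that the clock of width `k` has completed at time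
`t`.  The carries need `k` steps to travel through the clock, so it lags `k` steps behind. -/
def clockRound (k t : ℕ) : ℕ := (t - k) / 2 ^ k

/-- The address that the clock of width `k` displays at time `t`: all smaller addresses have been
treated in the current round. -/
def clockAddress (k t : ℕ) : ℕ := (t - k) % 2 ^ k

/-- The end of the range of addresses that the clock of width `k` has displayed in the current round
up to and including time `t`.  No address is displayed before time `k`. -/
def clockFrontier (k t : ℕ) : ℕ := if k ≤ t then clockAddress k t + 1 else 0

section Clock

variable {k t : ℕ}

lemma add_one_sub_cases (i t : ℕ) :
    (i ≤ t ∧ t + 1 - i = t - i + 1) ∨ (t < i ∧ t + 1 - i = t - i ∧ ¬ 2 ^ i ∣ t - i + 1) := by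
  rcases le_or_gt i t with h | h
  · exact .inl ⟨h, Nat.sub_add_comm h⟩
  · refine .inr ⟨h, by omega, ?_⟩
    rw [Nat.sub_eq_zero_of_le h.le, zero_add, Nat.dvd_one]
    exact (Nat.one_lt_two_pow (by omega)).ne'

lemma clockAddress_lt : clockAddress k t < 2 ^ k := Nat.mod_lt _ (by positivity)

lemma two_pow_dvd_sub_add_one_iff : 2 ^ k ∣ t - k + 1 ↔ clockAddress k t + 1 = 2 ^ k := by
  obtain ⟨b, hb⟩ := Nat.exists_eq_add_one.2 (Nat.two_pow_pos k)
  rw [clockAddress, hb, Nat.dvd_iff_mod_eq_zero, Nat.succ_mod_succ_eq_zero_iff,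
    Nat.add_right_cancel_iff]

lemma clockRound_add_one :
    clockRound k (t + 1) = clockRound k t + if 2 ^ k ∣ t - k + 1 then 1 else 0 := by
  unfold clockRound
  obtain ⟨-, h⟩ | ⟨-, h, hk⟩ := add_one_sub_cases k t
  · rw [h, Nat.succ_div]
  · rw [h, if_neg hk, add_zero]

lemma clockAddress_add_one :
    clockAddress k (t + 1) = if 2 ^ k ∣ t - k + 1 then 0 else clockFrontier k t := by
  unfold clockFrontier
  obtain ⟨hle, h⟩ | ⟨hlt, h, hk⟩ := add_one_sub_cases k t
  · rw [if_pos hle, clockAddress, h]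
    split_ifs with hk
    · exact Nat.mod_eq_zero_of_dvd hk
    · rw [clockAddress, ← Nat.mod_add_mod, Nat.mod_eq_of_lt]
      exact Nat.lt_of_le_of_ne clockAddress_lt (mt two_pow_dvd_sub_add_one_iff.2 hk)
  · rw [if_neg hk, if_neg hlt.not_ge, clockAddress, h, Nat.sub_eq_zero_of_le hlt.le, Nat.zero_mod]

lemma clockFrontier_of_dvd (h : 2 ^ k ∣ t - k + 1) : clockFrontier k t = 2 ^ k := by
  obtain ⟨hle, -⟩ | ⟨-, -, hk⟩ := add_one_sub_cases k t
  · rw [clockFrontier, if_pos hle, two_pow_dvd_sub_add_one_iff.1 h]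
  · exact absurd h hk

lemma lt_clockFrontier_iff {c : ℕ} :
    c < clockFrontier k t ↔ c < clockAddress k t ∨ k ≤ t ∧ c = clockAddress k t := by
  rw [clockFrontier]
  split_ifs with h
  · simp only [h, true_and, Nat.lt_succ_iff_lt_or_eq]
  · simp [h, clockAddress, Nat.sub_eq_zero_of_le (not_le.1 h).le]

lemma clockRound_monotone (k : ℕ) : Monotone (clockRound k) :=
  fun _ _ h => Nat.div_le_div_right (Nat.sub_le_sub_right h k)

lemma clockRound_mul_add (k n : ℕ) : clockRound k (n * 2 ^ k + k) = n := by
  rw [clockRound, Nat.add_sub_cancel, Nat.mul_div_cancel _ (by positivity)]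

lemma clockRound_surjective (k : ℕ) : Function.Surjective (clockRound k) :=
  fun n => ⟨_, clockRound_mul_add k n⟩

lemma exists_le_clockRound_eq (k n : ℕ) : ∃ t ≤ 2 ^ (2 * k) * n, clockRound k t = n := by
  rcases n.eq_zero_or_pos with rfl | hn
  · exact ⟨0, Nat.zero_le _, by rw [clockRound, Nat.zero_sub, Nat.zero_div]⟩
  · refine ⟨n * 2 ^ k + k, ?_, clockRound_mul_add k n⟩
    have hk : k + 1 ≤ 2 ^ k := Nat.lt_two_pow_self
    calc n * 2 ^ k + k
      _ ≤ n * 2 ^ k + n * 2 ^ k * k := by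
        gcongr
        exact Nat.le_mul_of_pos_left k (by positivity)
      _ = n * 2 ^ k * (k + 1) := by ring
      _ ≤ n * 2 ^ k * 2 ^ k := Nat.mul_le_mul_left _ hk
      _ = 2 ^ (2 * k) * n := by rw [two_mul, pow_add]; ring

end Clock

/-! ### Identifiers as numbers -/

section BitStrings

variable {n : ℕ} {f g : Fin n → Bool}

lemma ofBits_rev_lt_of_ofFn_lt (h : List.ofFn f < List.ofFn g) :
    Nat.ofBits (fun i => f i.rev) < Nat.ofBits fun i => g i.rev := by
  obtain ⟨-, hlen⟩ | ⟨i, hi, _, heq, hlt⟩ := List.lt_iff_exists.1 h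
  · simp at hlen
  rw [List.length_ofFn] at hi
  simp only [List.getElem_ofFn] at heq hlt
  lift i to Fin n using hi
  have testBit_rev (f : Fin n → Bool) : (Nat.ofBits fun i => f i.rev).testBit i.rev = f i := by
    rw [Nat.testBit_ofBits_lt _ _ i.rev.isLt, Fin.eta, Fin.rev_rev]
  refine Nat.lt_of_testBit i.rev ?_ ?_ fun j hj => ?_
  · exact (testBit_rev f).trans (Bool.lt_iff.1 hlt).1
  · exact (testBit_rev g).trans (Bool.lt_iff.1 hlt).2
  · rcases lt_or_ge j n with hjn | hjn
    · rw [Nat.testBit_ofBits_lt _ _ hjn, Nat.testBit_ofBits_lt _ _ hjn]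
      exact heq (n - (j + 1)) (by rw [Fin.val_rev] at hj; omega)
    · rw [Nat.testBit_ofBits_ge _ _ hjn, Nat.testBit_ofBits_ge _ _ hjn]

lemma ofBits_rev_lt_iff :
    (Nat.ofBits (fun i => f i.rev) < Nat.ofBits fun i => g i.rev) ↔
      List.ofFn f < List.ofFn g := by
  refine ⟨fun h => ?_, ofBits_rev_lt_of_ofFn_lt⟩
  obtain hlt | heq | hgt := lt_trichotomy (List.ofFn f) (List.ofFn g)
  · exact hlt
  · exact absurd (List.ofFn_injective heq ▸ h) (lt_irrefl _)
  · exact absurd h (ofBits_rev_lt_of_ofFn_lt hgt).not_gt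

end BitStrings

/-- The symbol of `s` whose truth value is the bit of weight `2 ^ i` of the address of a node.
Since identifiers are compared lexicographically, their first symbol is the most significant one. -/
def addressSymbol {P : Type u} [LinearOrder P] (s : Finset P) (i : Fin s.card) : P :=
  s.orderEmbOfFin rfl i.rev

lemma addressSymbol_mem {P : Type u} [LinearOrder P] (s : Finset P) (i : Fin s.card) :
    addressSymbol s i ∈ s :=
  s.orderEmbOfFin_mem rfl _

namespace KripkeModel

variable {P : Type u} [LinearOrder P] {S : Finset P} {M : KripkeModel.{u, w} S}

open Classical in
/-- The address of a node: its identifier with respect to the symbols in `s`, read as a binary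
number. -/
noncomputable def address (M : KripkeModel.{u, w} S) (s : Finset P) (x : M.W) : ℕ :=
  Nat.ofBits fun i => decide (M.Holds x (addressSymbol s i))

/-- The number of successors of `x` with an address below `c`. -/
noncomputable def below (M : KripkeModel.{u, w} S) (s : Finset P) (x : M.W) (c : ℕ) : ℕ :=
  {z | M.R x z ∧ M.address s z < c}.ncard

lemma address_lt {s : Finset P} {x : M.W} : M.address s x < 2 ^ s.card := Nat.ofBits_lt_two_pow _

lemma testBit_address {s : Finset P} {x : M.W} (i : Fin s.card) :
    (M.address s x).testBit i = true ↔ M.Holds x (addressSymbol s i) := by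
  classical
  rw [address, Nat.testBit_ofBits_lt _ _ i.isLt, decide_eq_true_iff]

section Identifiers

variable {PROP₁ : Set P} {s : Finset P} {x y : M.W}

open Classical in
lemma ident_eq_ofFn : M.ident PROP₁ x =
    List.ofFn fun i => decide (M.Holds x ((distinguished PROP₁ S).orderEmbOfFin rfl i)) := by
  refine List.ext_getElem (by simp [ident]) fun i _ _ => ?_
  simp only [ident, List.getElem_map, List.getElem_ofFn, Finset.orderEmbOfFin_apply,
    Fin.getElem_fin]
  rfl

lemma address_lt_address_iff :
    M.address (distinguished PROP₁ S) x < M.address (distinguished PROP₁ S) y ↔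
      M.ident PROP₁ x < M.ident PROP₁ y := by
  rw [ident_eq_ofFn, ident_eq_ofFn, ← ofBits_rev_lt_iff]
  rfl

lemma HasIdentifiers.address_injective (hM : M.HasIdentifiers PROP₁)
    (hs : distinguished PROP₁ S = s) : Function.Injective (M.address s) := by
  subst hs
  exact fun _ _ h => hM (le_antisymm (not_lt.1 (mt address_lt_address_iff.2 h.not_gt))
    (not_lt.1 (mt address_lt_address_iff.2 h.not_lt)))

lemma numberedAcc_iff (hs : distinguished PROP₁ S = s) {i : ℕ+} :
    M.numberedAcc PROP₁ i x y ↔ M.R x y ∧ M.below s x (M.address s y) + 1 = i := by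
  subst hs
  simp only [numberedAcc, below, address_lt_address_iff]

end Identifiers

section Below

variable {s : Finset P} {x : M.W} {c : ℕ}

lemma below_zero : M.below s x 0 = 0 := by
  simp only [below, not_lt_zero, and_false, Set.ofPred_false, Set.ncard_empty]

lemma below_add_one_of_exists (hinj : Function.Injective (M.address s))
    (h : ∃ y, M.R x y ∧ M.address s y = c) : M.below s x (c + 1) = M.below s x c + 1 := by
  obtain ⟨y, hxy, rfl⟩ := h
  have hfin : {z | M.R x z ∧ M.address s z < M.address s y}.Finite :=
    ((Set.finite_Iio (M.address s y)).preimage hinj.injOn).subset fun z hz => hz.2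
  rw [below, below, ← Set.ncard_insert_of_notMem (fun hy => hy.2.false) hfin]
  congr 1
  ext z
  simp only [Set.mem_ofPred_eq, Set.mem_insert_iff, Nat.lt_succ_iff, le_iff_eq_or_lt, hinj.eq_iff]
  grind

lemma below_add_one_of_not_exists (h : ¬ ∃ y, M.R x y ∧ M.address s y = c) :
    M.below s x (c + 1) = M.below s x c := by
  rw [below, below]
  congr 1
  ext z
  simp only [Set.mem_ofPred_eq, Nat.lt_succ_iff, le_iff_eq_or_lt]
  exact and_congr_right fun hz => or_iff_right fun hc => h ⟨z, hz, hc⟩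

end Below

end KripkeModel

namespace Program

/-! ### Programs with prescribed head predicates -/

section Valuation

variable {P : Type u} {VAR : Type v} {D : Type} {S : Finset P}

/-- The interpretation of the head predicates in round `n`. -/
def valuation (Λ : Program P VAR D) (M : KripkeModel.{u, w} S) (acc : D → M.W → M.W → Prop)
    (n : ℕ) (Y : {Y // Y ∈ Λ.heads}) (x : M.W) : Prop :=
  M.Sat acc x (Λ.iterFormula n Y)

lemma valuation_add_one {Λ : Program P VAR D} {M : KripkeModel.{u, w} S}
    {acc : D → M.W → M.W → Prop} {n : ℕ} {Y : {Y // Y ∈ Λ.heads}} {x : M.W} :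
    Λ.valuation M acc (n + 1) Y x ↔ M.Eval acc (Λ.valuation M acc n) (Λ.iter Y).toSchema x :=
  KripkeModel.sat_next

end Valuation

lemma exists_equiv_extending {VAR : Type v} [Infinite VAR] {Z : Type w} [Finite Z]
    (s : Finset VAR) (ι : {Y // Y ∈ s} ↪ Z) :
    ∃ (t : Finset VAR) (e : Z ≃ {Y // Y ∈ t}), ∀ Y, (e (ι Y) : VAR) = Y := by
  have := Fintype.ofFinite Z
  have hcard : s.card ≤ Fintype.card Z := by
    simpa only [Fintype.card_coe] using Fintype.card_le_of_embedding ι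
  obtain ⟨t, hst, ht⟩ := Infinite.exists_superset_card_eq s _ hcard
  have hval : ∀ Y, Function.extend ι Subtype.val (fun _ => Classical.arbitrary VAR) (ι Y) = Y :=
    ι.injective.extend_apply _ _
  obtain ⟨e, he⟩ := Set.MapsTo.exists_equiv_extend_of_card_eq (s := Set.range ι) ht.symm
    (f := Function.extend ι Subtype.val fun _ => Classical.arbitrary VAR)
    (by rintro _ ⟨Y, rfl⟩; rw [hval]; exact hst Y.2)
    (by
      rintro _ ⟨Y, rfl⟩ _ ⟨Z, rfl⟩ h
      rw [hval, hval] at h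
      rw [Subtype.ext h])
  exact ⟨t, e, fun Y => (he _ ⟨Y, rfl⟩).trans (hval Y)⟩

section OfEquiv

variable {P : Type u} {VAR : Type v} {D : Type} {Z : Type*} [Nonempty Z] {t : Finset VAR}

/-- The program whose head predicates are indexed by `Z` along `e`, with the given terminal bodies
and standard iteration clauses. -/
abbrev ofEquiv (e : Z ≃ {Y // Y ∈ t}) (term : Z → Formula P D) (iter : Z → Schema P Z D)
    (attention print : Finset Z) : Program P VAR D where
  heads := t
  heads_nonempty := let ⟨z⟩ := ‹Nonempty Z›; ⟨e z, (e z).2⟩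
  term Y := term (e.symm Y)
  iter Y := ⟨[], (iter (e.symm Y)).rename e⟩
  attention := attention.map e.toEmbedding
  print := print.map e.toEmbedding

variable {e : Z ≃ {Y // Y ∈ t}} {term : Z → Formula P D} {attention print : Finset Z}

lemma isMSC_ofEquiv {term : Z → Formula P Unit} {iter : Z → Schema P Z Unit} :
    (ofEquiv e term iter attention print).IsMSC :=
  fun _ => rfl

variable {iter : Z → Schema P Z D}

lemma length_ofEquiv_le [Fintype Z] : (ofEquiv e term iter attention print).length ≤
    ∑ z, ((term z).length + (iter z).length + 2) := by
  rw [← e.symm.sum_comp]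
  refine Finset.sum_le_sum fun Y _ => ?_
  have := (iter (e.symm Y)).length_rename_le (f := e)
  simp only [ofEquiv, Clause.length, List.map_nil, List.sum_nil]
  omega

lemma isOver_ofEquiv {S : Finset P} (hterm : ∀ z, (term z).props ⊆ S)
    (hiter : ∀ z, (iter z).props ⊆ S) : (ofEquiv e term iter attention print).IsOver S := by
  rintro p ⟨Y, hp | hp⟩
  · exact hterm _ hp
  · rw [← Clause.props_toSchema] at hp
    exact hiter _ (Schema.props_rename_subset _ hp)

lemma valuation_ofEquiv {S : Finset P} {M : KripkeModel.{u, w} S} {acc : D → M.W → M.W → Prop}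
    {F : ℕ → Z → M.W → Prop} (hterm : ∀ z x, M.Sat acc x (term z) ↔ F 0 z x)
    (hiter : ∀ n z x, M.Eval acc (F n) (iter z) x ↔ F (n + 1) z x) (n : ℕ) (z : Z) (x : M.W) :
    (ofEquiv e term iter attention print).valuation M acc n (e z) x ↔ F n z x := by
  induction n generalizing z x with
  | zero => simpa only [valuation, iterFormula, e.symm_apply_apply] using hterm z x
  | succ n ih =>
    rw [valuation_add_one, ← hiter, ← KripkeModel.eval_rename ih]
    simp only [Clause.toSchema, List.foldr_nil, e.symm_apply_apply]

end OfEquiv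

end Program

/-! ### Slowed-down simulation -/

lemma accepts_comp {ι : Type v} {b : ℕ → ι → Bool} {A : Finset ι} {f : ℕ → ℕ} (hf : Monotone f)
    (hsurj : Function.Surjective f) (t : ℕ) :
    Accepts (fun t => b (f t)) A t ↔ Accepts b A (f t) ∧ ∀ t' < t, f t' ≠ f t := by
  constructor
  · rintro ⟨⟨i, hi, hbi⟩, hno⟩
    refine ⟨⟨⟨i, hi, hbi⟩, fun m hm j hj => ?_⟩, fun t' ht' heq => ?_⟩
    · obtain ⟨t', rfl⟩ := hsurj m
      exact hno t' (hf.reflect_lt hm) j hj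
    · simpa only [heq, hbi, Bool.true_eq_false] using hno t' ht' i hi
  · rintro ⟨⟨hacc, hno⟩, hfirst⟩
    exact ⟨hacc, fun t' ht' => hno (f t') ((hf ht'.le).lt_of_ne (hfirst t' ht'))⟩

lemma accepts_map {ι : Type v} {κ : Type w} {b : ℕ → κ → Bool} {A : Finset ι} (j : ι ↪ κ) (t : ℕ) :
    Accepts b (A.map j) t ↔ Accepts (fun n i => b n (j i)) A t := by
  simp only [Accepts, Finset.mem_map, exists_exists_and_eq_and, forall_exists_index, and_imp,
    forall_apply_eq_imp_iff₂]

namespace Program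

section IsSimulation

variable {P : Type u} [LinearOrder P] {VAR : Type v} [LinearOrder VAR]

/-- The program `Γ` simulates `Λ` along the clock `f` and the inclusion `j` of the head predicates:
the head predicates of `Λ` have at time `t` in `Γ` the truth values of the round `f t` of `Λ`. -/
structure IsSimulation (PROP₁ : Set P) (S : Finset P) (Λ : Program P VAR ℕ+)
    (Γ : Program P VAR Unit) (f : ℕ → ℕ) (j : {Y // Y ∈ Λ.heads} ↪o {Y // Y ∈ Γ.heads}) :
    Prop where
  attention_eq : Γ.attention = Λ.attention.map j.toEmbedding
  print_eq : Γ.print = Λ.print.map j.toEmbedding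
  valuation_iff : ∀ (S' : Finset P), distinguished PROP₁ S' = distinguished PROP₁ S →
    ∀ M : KripkeModel.{u, w} S', M.HasIdentifiers PROP₁ → ∀ t Y x,
      Γ.valuation M M.plainAcc t (j Y) x ↔ Λ.valuation M (M.numberedAcc PROP₁) (f t) Y x

namespace IsSimulation

variable {PROP₁ : Set P} {S S' : Finset P} {Λ : Program P VAR ℕ+} {Γ : Program P VAR Unit}
  {f : ℕ → ℕ} {j : {Y // Y ∈ Λ.heads} ↪o {Y // Y ∈ Γ.heads}} {M : KripkeModel.{u, w} S'}

lemma outputsIn_iff (h : IsSimulation.{u, v, w} PROP₁ S Λ Γ f j) (hf : Monotone f)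
    (hsurj : Function.Surjective f) (hS : distinguished PROP₁ S' = distinguished PROP₁ S)
    (hM : M.HasIdentifiers PROP₁) {x : M.W} {s : List Bool} {t : ℕ} :
    Γ.OutputsIn M M.plainAcc x s t ↔
      Λ.OutputsIn M (M.numberedAcc PROP₁) x s (f t) ∧ ∀ t' < t, f t' ≠ f t := by
  have hconfig (t : ℕ) (Y) : Γ.config M M.plainAcc x t (j Y) =
      Λ.config M (M.numberedAcc PROP₁) x (f t) Y := by
    classical
    exact decide_eq_decide.2 (h.valuation_iff S' hS M hM t Y x)
  have hprint : (Γ.print.sort (· ≤ ·)).map (Γ.config M M.plainAcc x t) =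
      (Λ.print.sort (· ≤ ·)).map (Λ.config M (M.numberedAcc PROP₁) x (f t)) := by
    rw [h.print_eq, ← Finset.map_sort _ _ _ _ fun _ _ _ _ => j.le_iff_le.symm, List.map_map]
    exact List.map_congr_left fun Y _ => hconfig t Y
  have haccepts : Accepts (Γ.config M M.plainAcc x) Γ.attention t ↔
      Accepts (Λ.config M (M.numberedAcc PROP₁) x) Λ.attention (f t) ∧ ∀ t' < t, f t' ≠ f t := by
    rw [h.attention_eq, accepts_map, ← accepts_comp hf hsurj]
    simp only [RelEmbedding.coe_toEmbedding, hconfig]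
  rw [OutputsIn, OutputsIn, haccepts, hprint]
  tauto

lemma exists_outputsIn (h : IsSimulation.{u, v, w} PROP₁ S Λ Γ f j) (hf : Monotone f)
    (hsurj : Function.Surjective f) (hS : distinguished PROP₁ S' = distinguished PROP₁ S)
    (hM : M.HasIdentifiers PROP₁) {x : M.W} {s : List Bool} {t : ℕ}
    (hout : Λ.OutputsIn M (M.numberedAcc PROP₁) x s (f t)) :
    ∃ t' ≤ t, Γ.OutputsIn M M.plainAcc x s t' := by
  classical
  have hex : ∃ t', f t' = f t := ⟨t, rfl⟩
  refine ⟨Nat.find hex, Nat.find_min' hex rfl, (h.outputsIn_iff hf hsurj hS hM).2 ?_⟩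
  rw [Nat.find_spec hex]
  exact ⟨hout, fun t' ht' => Nat.find_min hex ht'⟩

lemma equivalent (h : IsSimulation.{u, v, w} PROP₁ S Λ Γ f j) (hf : Monotone f)
    (hsurj : Function.Surjective f) : Equivalent.{u, v, w} PROP₁ S Λ Γ := by
  refine fun S' hS M hM _ _ x s => ⟨fun ⟨n, hn⟩ => ?_, fun ⟨t, ht⟩ => ?_⟩
  · obtain ⟨t, rfl⟩ := hsurj n
    obtain ⟨t', -, ht'⟩ := h.exists_outputsIn hf hsurj hS hM hn
    exact ⟨t', ht'⟩
  · exact ⟨f t, ((h.outputsIn_iff hf hsurj hS hM).1 ht).1⟩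

lemma timeAtMost {T : ℕ} (h : IsSimulation.{u, v, w} PROP₁ S Λ Γ f j) (hf : Monotone f)
    (hT : ∀ n, ∃ t ≤ T * n, f t = n) : TimeAtMost.{u, v, w} PROP₁ S Λ Γ T := by
  intro S' hS M hM _ _ x s n hn
  obtain ⟨t, ht, rfl⟩ := hT n
  obtain ⟨t', ht', hout⟩ :=
    h.exists_outputsIn hf (fun n => (hT n).imp fun _ h => h.2) hS hM hn
  exact ⟨t', ht'.trans ht, hout⟩

end IsSimulation

end IsSimulation

/-! ### The simulating program -/

section Body

variable {P : Type u} {VAR : Type v}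

/-- The right-hand side of the iteration clause of `Y`, as a single schema. -/
def body {D : Type} (Λ : Program P VAR D) (Y : {Y // Y ∈ Λ.heads}) :
    Schema P {Y // Y ∈ Λ.heads} D :=
  (Λ.iter Y).toSchema

variable {Λ : Program P VAR ℕ+} {Y : {Y // Y ∈ Λ.heads}}

lemma IsMPMSC.md_body_le (hΛ : Λ.IsMPMSC) : (Λ.body Y).md ≤ 1 :=
  Clause.md_toSchema_le (fun b hb => ⟨by rw [((hΛ Y).2.1 b hb).1]; exact zero_le_one,
    ((hΛ Y).2.1 b hb).2⟩) (hΛ Y).2.2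

lemma le_maxIndex_of_mem_diaSubs_body {d} (hd : d ∈ (Λ.body Y).diaSubs) :
    (d.1 : ℕ) ≤ Λ.maxIndex :=
  calc (d.1 : ℕ)
    _ ≤ (Λ.body Y).maxIndex := Schema.le_maxIndex_of_mem_diaSubs hd
    _ = (Λ.iter Y).maxIndex := Clause.maxIndex_toSchema _
    _ ≤ max (Λ.term Y).maxIndex (Λ.iter Y).maxIndex := le_max_right _ _
    _ ≤ Λ.maxIndex := Finset.le_sup
      (f := fun Y => max (Λ.term Y).maxIndex (Λ.iter Y).maxIndex) (Finset.mem_univ Y)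

lemma props_body_subset {S : Finset P} (hS : Λ.IsOver S) : (Λ.body Y).props ⊆ S := by
  rw [body, Clause.props_toSchema]
  exact fun _ hp => hS ⟨Y, .inr hp⟩

lemma props_term_subset {S : Finset P} (hS : Λ.IsOver S) : (Λ.term Y).props ⊆ S :=
  fun _ hp => hS ⟨Y, .inl hp⟩

end Body

section Construction

variable {P : Type u} {VAR : Type v}

/-- The head predicates of the program that simulates `Λ` on nodes with addresses of `k` bits:
* `orig Y` holds the value of the head predicate `Y` of `Λ`;
* `bit i` and `carry i` are the bits of a counter and the carries into them, where position `i` lags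
  `i` steps behind position `0`;
* `matching i` says that the `i` lowest bits of the counter agree with those of the address;
* `seen j` says that at least `j` successors have an address that was displayed in this round;
* `dia Y d` says that the diamond subschema `d` of the body of `Y` has been witnessed in this
  round. -/
inductive SimHead (Λ : Program P VAR ℕ+) (k : ℕ) : Type (max u v)
  | orig (Y : {Y // Y ∈ Λ.heads})
  | bit (i : Fin k)
  | carry (i : Fin (k + 1))
  | matching (i : Fin (k + 1))
  | seen (j : Fin (Λ.maxIndex + 1))
  | dia (Y : {Y // Y ∈ Λ.heads}) (d : {d // d ∈ (Λ.body Y).diaSubs})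

namespace SimHead

variable {Λ : Program P VAR ℕ+} {k : ℕ}

/-- The head predicates as a disjoint union, which makes them a finite type. -/
def equivSum : SimHead Λ k ≃ {Y // Y ∈ Λ.heads} ⊕ Fin k ⊕ Fin (k + 1) ⊕ Fin (k + 1) ⊕
    Fin (Λ.maxIndex + 1) ⊕ Σ Y, {d // d ∈ (Λ.body Y).diaSubs} where
  toFun
    | orig Y => .inl Y
    | bit i => .inr (.inl i)
    | carry i => .inr (.inr (.inl i))
    | matching i => .inr (.inr (.inr (.inl i)))
    | seen j => .inr (.inr (.inr (.inr (.inl j))))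
    | dia Y d => .inr (.inr (.inr (.inr (.inr ⟨Y, d⟩))))
  invFun := Sum.elim orig <| Sum.elim bit <| Sum.elim carry <| Sum.elim matching <|
    Sum.elim seen fun ⟨Y, d⟩ => dia Y d
  left_inv := by rintro (_ | _ | _ | _ | _ | _) <;> rfl
  right_inv := by rintro (_ | _ | _ | _ | _ | _) <;> rfl

noncomputable instance : Fintype (SimHead Λ k) := .ofEquiv _ equivSum.symm

instance : Nonempty (SimHead Λ k) := ⟨carry 0⟩

lemma sum_univ (f : SimHead Λ k → ℕ) :
    ∑ z, f z = ∑ Y, f (orig Y) + ∑ i, f (bit i) + ∑ i, f (carry i) + ∑ i, f (matching i) +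
      ∑ j, f (seen j) + ∑ Y, ∑ d, f (dia Y d) := by
  rw [← equivSum.symm.sum_comp]
  simp only [Fintype.sum_sum_type, Fintype.sum_sigma, add_assoc]
  rfl

end SimHead

open Schema SimHead

/-- The schema saying that the counter overflows, which ends a round. -/
def tick (Λ : Program P VAR ℕ+) (k : ℕ) : Schema P (SimHead Λ k) Unit := var (carry (Fin.last k))

/-- The schema saying that the counter displays the address of the current node. -/
def active (Λ : Program P VAR ℕ+) (k : ℕ) : Schema P (SimHead Λ k) Unit :=
  var (matching (Fin.last k))

open Classical in
/-- The translation of the subschemata of the body of `Y`: a diamond holds if it has been witnessed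
earlier in this round, or if it is witnessed now by the active successor, whose number among the
successors is determined by the predicates `seen`. -/
noncomputable def simTrans (Λ : Program P VAR ℕ+) (k : ℕ) (Y : {Y // Y ∈ Λ.heads}) :
    Schema P {Y // Y ∈ Λ.heads} ℕ+ → Schema P (SimHead Λ k) Unit :=
  translate orig fun i ψ ψ' =>
    if h : (i, ψ) ∈ (Λ.body Y).diaSubs then
      .or (var (.dia Y ⟨(i, ψ), h⟩))
        (and (and (var (seen (Fin.ofNat _ (i - 1)))) (neg (var (seen (Fin.ofNat _ i)))))
          (.dia () (and (active Λ k) ψ')))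
    else top

/-- The terminal bodies of the simulating program. -/
def simTerm (Λ : Program P VAR ℕ+) (k : ℕ) : SimHead Λ k → Formula P Unit
  | orig Y => (Λ.term Y).translate id fun _ _ _ => top
  | bit _ | .dia _ _ => neg top
  | carry i | matching i | seen i => if i = 0 then top else neg top

variable [LinearOrder P]

/-- The iteration bodies of the simulating program.  The diamonds are accumulated during a round,
and the head predicates of `Λ` are updated at its end. -/
noncomputable def simBody (Λ : Program P VAR ℕ+) (s : Finset P) :
    SimHead Λ s.card → Schema P (SimHead Λ s.card) Unit
  | orig Y => .ite (tick Λ _) (Λ.simTrans _ Y (Λ.body Y)) (var (orig Y))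
  | bit i => .ite (var (carry i.castSucc)) (neg (var (bit i))) (var (bit i))
  | carry i => Fin.cases top (fun i => and (var (carry i.castSucc)) (var (bit i))) i
  | matching i => Fin.cases top (fun i => and (var (matching i.castSucc))
      (.ite (var (bit i)) (prop (addressSymbol s i)) (neg (prop (addressSymbol s i))))) i
  | seen j => Fin.cases top (fun j => and (neg (tick Λ _)) (.or (var (seen j.succ))
      (and (var (seen j.castSucc)) (.dia () (active Λ _))))) j
  | .dia Y d => and (neg (tick Λ _)) (Λ.simTrans _ Y (.dia d.1.1 d.1.2))

end Construction

/-! ### Symbols and length of the simulating program -/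

section Size

variable {P : Type u} {VAR : Type v} {Λ : Program P VAR ℕ+} {S : Finset P} {k : ℕ}

lemma props_simTrans_subset {Y} {φ} (h : φ.props ⊆ (S : Set P)) :
    (Λ.simTrans k Y φ).props ⊆ S := by
  refine Schema.props_translate_subset (fun i ψ ψ' hψ' => ?_) h
  split_ifs
  · simpa only [Schema.props_or, Schema.props, active, Set.empty_union] using hψ'
  · exact Set.empty_subset _

lemma props_simTerm_subset (hS : Λ.IsOver S) (z : SimHead Λ k) :
    (Λ.simTerm k z).props ⊆ S := by
  cases z with
  | orig Y =>
    exact Schema.props_translate_subset (fun _ _ _ _ => Set.empty_subset _) (props_term_subset hS)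
  | bit | dia => exact Set.empty_subset _
  | carry | matching | seen => simp only [simTerm]; split_ifs <;> exact Set.empty_subset _

lemma length_simTrans_le {k : ℕ} {Y} (φ) : (Λ.simTrans k Y φ).length ≤ 13 * φ.length := by
  refine Schema.length_translate_le (by norm_num) (fun i ψ ψ' => ?_) φ
  split_ifs
  · simp only [Schema.length_or, Schema.length, active]; omega
  · simp only [Schema.length]; omega

lemma length_simTerm_orig_le {k : ℕ} (Y) :
    (Λ.simTerm k (.orig Y)).length ≤ (Λ.term Y).length :=
  (Schema.length_translate_le le_rfl (fun _ _ _ => Nat.le_add_left _ _) _).trans_eq (one_mul _)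

lemma length_simTerm_le {k : ℕ} {z : SimHead Λ k} (hz : ∀ Y, z ≠ .orig Y) :
    (Λ.simTerm k z).length ≤ 2 := by
  cases z with
  | orig Y => exact absurd rfl (hz Y)
  | bit | dia => exact le_rfl
  | carry | matching | seen => simp only [simTerm]; split_ifs <;> simp [Schema.length]

lemma length_pos {D : Type} (Λ : Program P VAR D) : 0 < Λ.length :=
  let ⟨Y, hY⟩ := Λ.heads_nonempty
  Finset.sum_pos (fun _ _ => by omega) ⟨⟨Y, hY⟩, Finset.mem_univ _⟩

variable [LinearOrder P] {s : Finset P}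

lemma props_simBody_subset (hS : Λ.IsOver S) (hs : s ⊆ S) (z : SimHead Λ s.card) :
    (Λ.simBody s z).props ⊆ S := by
  cases z with
  | orig Y =>
    simpa only [simBody, Schema.props_ite, Schema.props, tick, Set.empty_union, Set.union_empty]
      using props_simTrans_subset (props_body_subset hS)
  | bit i => simp [simBody, Schema.props_ite, Schema.props]
  | carry i => cases i using Fin.cases <;> simp [simBody, Schema.props]
  | matching i =>
    cases i using Fin.cases with
    | zero => simp [simBody, Schema.props]
    | succ i => simpa [simBody, Schema.props, Schema.props_ite] using hs (addressSymbol_mem s i)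
  | seen j =>
    cases j using Fin.cases <;> simp [simBody, Schema.props, Schema.props_or, tick, active]
  | dia Y d =>
    have hd : (Schema.dia d.1.1 d.1.2).props ⊆ (S : Set P) :=
      (Schema.props_subset_of_mem_diaSubs d.2).trans (props_body_subset hS)
    simpa only [simBody, Schema.props, tick, Set.empty_union] using props_simTrans_subset hd

lemma length_simBody_orig_le (Y) : (Λ.simBody s (.orig Y)).length ≤ 127 * (Λ.iter Y).length := by
  have hbody : (Λ.body Y).length ≤ 9 * (Λ.iter Y).length := Clause.length_toSchema_le _
  have htrans := length_simTrans_le (k := s.card) (Y := Y) (Λ.body Y)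
  have hpos := (Λ.body Y).length_pos
  simp only [simBody, Schema.length_ite, Schema.length, tick]
  omega

lemma length_simBody_dia_le (Y) (d) :
    (Λ.simBody s (.dia Y d)).length ≤ 16 * (d.1.2.length + 1) := by
  have := length_simTrans_le (k := s.card) (Y := Y) (.dia d.1.1 d.1.2)
  simp only [simBody, Schema.length, tick] at this ⊢
  omega

lemma length_simBody_le {z : SimHead Λ s.card} (horig : ∀ Y, z ≠ .orig Y)
    (hdia : ∀ Y d, z ≠ .dia Y d) : (Λ.simBody s z).length ≤ 14 := by
  cases z with
  | orig Y => exact absurd rfl (horig Y)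
  | dia Y d => exact absurd rfl (hdia Y d)
  | bit => simp [simBody, Schema.length_ite, Schema.length]
  | carry i | matching i | seen i =>
    cases i using Fin.cases <;>
      simp [simBody, Schema.length_ite, Schema.length_or, Schema.length, tick, active]

lemma sum_length_simBody_dia_le (hΛ : Λ.IsMPMSC) (Y) :
    ∑ d, ((Λ.simTerm s.card (.dia Y d)).length + (Λ.simBody s (.dia Y d)).length + 2) ≤
      180 * (Λ.iter Y).length :=
  calc _
    _ ≤ ∑ d : {d // d ∈ (Λ.body Y).diaSubs}, 20 * (d.1.2.length + 1) := by
      refine Finset.sum_le_sum fun d _ => ?_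
      have hterm : (Λ.simTerm s.card (.dia Y d)).length ≤ 2 := length_simTerm_le nofun
      have hbody := length_simBody_dia_le (s := s) Y d
      omega
    _ = 20 * ∑ d ∈ (Λ.body Y).diaSubs, (d.2.length + 1) := by
      rw [Finset.mul_sum]
      exact Finset.sum_coe_sort (Λ.body Y).diaSubs fun d => 20 * (d.2.length + 1)
    _ ≤ 20 * (Λ.body Y).length := Nat.mul_le_mul_left _ (Schema.sum_length_diaSubs_le hΛ.md_body_le)
    _ ≤ 180 * (Λ.iter Y).length := by
      have : (Λ.body Y).length ≤ 9 * (Λ.iter Y).length := Clause.length_toSchema_le _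
      omega

lemma sum_length_sim_le (hΛ : Λ.IsMPMSC) :
    ∑ z, ((Λ.simTerm s.card z).length + (Λ.simBody s z).length + 2) ≤
      400 * (Λ.maxIndex + s.card + Λ.length) := by
  have hpos := Λ.length_pos
  have hclock (z : SimHead Λ s.card) (horig : ∀ Y, z ≠ .orig Y) (hdia : ∀ Y d, z ≠ .dia Y d) :
      (Λ.simTerm s.card z).length + (Λ.simBody s z).length + 2 ≤ 18 := by
    have := length_simTerm_le horig
    have := length_simBody_le horig hdia
    omega
  have hsum {n : ℕ} (f : Fin n → SimHead Λ s.card) (horig : ∀ i Y, f i ≠ .orig Y)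
      (hdia : ∀ i Y d, f i ≠ .dia Y d) :
      ∑ i, ((Λ.simTerm s.card (f i)).length + (Λ.simBody s (f i)).length + 2) ≤ n * 18 := by
    refine (Finset.sum_le_card_nsmul _ _ 18 fun i _ => hclock _ (horig i) (hdia i)).trans_eq ?_
    rw [Finset.card_univ, Fintype.card_fin, smul_eq_mul]
  have hprog : ∑ Y, ((Λ.simTerm s.card (.orig Y)).length + (Λ.simBody s (.orig Y)).length + 2) +
      ∑ Y, ∑ d, ((Λ.simTerm s.card (.dia Y d)).length + (Λ.simBody s (.dia Y d)).length + 2) ≤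
        307 * Λ.length := by
    rw [← Finset.sum_add_distrib, length, Finset.mul_sum]
    refine Finset.sum_le_sum fun Y _ => ?_
    have := length_simTerm_orig_le (k := s.card) Y
    have := length_simBody_orig_le (s := s) Y
    have := sum_length_simBody_dia_le (s := s) hΛ Y
    omega
  have hbit := hsum .bit nofun nofun
  have hcarry := hsum .carry nofun nofun
  have hmatching := hsum .matching nofun nofun
  have hseen := hsum .seen nofun nofun
  rw [SimHead.sum_univ]
  linarith

end Size

end Program

/-! ### Correctness of the simulating program -/

namespace KripkeModel

variable {P : Type u} [LinearOrder P] {S : Finset P}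

/-- The interpretation of the numbered diamonds restricted to neighbours with an address below
`c`. -/
def numberedAccBelow (M : KripkeModel.{u, w} S) (PROP₁ : Set P) (s : Finset P) (c : ℕ) :
    ℕ+ → M.W → M.W → Prop :=
  fun i x y => M.numberedAcc PROP₁ i x y ∧ M.address s y < c

lemma numberedAccBelow_two_pow {M : KripkeModel.{u, w} S} {PROP₁ : Set P} {s : Finset P} :
    M.numberedAccBelow PROP₁ s (2 ^ s.card) = M.numberedAcc PROP₁ := by
  ext i x y
  exact and_iff_left address_lt

end KripkeModel

namespace Program

variable {P : Type u} [LinearOrder P] {VAR : Type v} {S : Finset P}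

/-- The interpretation of the head predicates of the simulating program at time `t`. -/
def simState (Λ : Program P VAR ℕ+) (M : KripkeModel.{u, w} S) (PROP₁ : Set P) (s : Finset P)
    (t : ℕ) : SimHead Λ s.card → M.W → Prop
  | .orig Y, x => Λ.valuation M (M.numberedAcc PROP₁) (clockRound s.card t) Y x
  | .bit i, _ => (t - i).testBit i = true
  | .carry i, _ => 2 ^ (i : ℕ) ∣ t - i + 1
  | .matching i, x => i ≤ t ∧ t - i ≡ M.address s x [MOD 2 ^ (i : ℕ)]
  | .seen j, x => j ≤ M.below s x (clockAddress s.card t)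
  | .dia _ d, x => M.Eval (M.numberedAccBelow PROP₁ s (clockAddress s.card t))
      (Λ.valuation M (M.numberedAcc PROP₁) (clockRound s.card t)) (.dia d.1.1 d.1.2) x

variable {Λ : Program P VAR ℕ+} {M : KripkeModel.{u, w} S} {PROP₁ : Set P} {s : Finset P} {t : ℕ}
  {x : M.W}

lemma sat_simTerm (hΛ : Λ.IsMPMSC) (z : SimHead Λ s.card) :
    M.Sat M.plainAcc x (Λ.simTerm s.card z) ↔ Λ.simState M PROP₁ s 0 z x := by
  cases z with
  | orig Y =>
    rw [simTerm, KripkeModel.sat_iff_eval, KripkeModel.eval_translate (fun Y => Y.elim)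
      (acc := M.numberedAcc PROP₁) (ν := fun Y _ => Y.elim), ← KripkeModel.sat_iff_eval]
    · simp only [simState, clockRound, Nat.zero_sub, Nat.zero_div]
      rfl
    · simp [Schema.diaSubs_eq_empty (hΛ Y).1]
  | bit i => simp [simTerm, simState, KripkeModel.Sat]
  | carry i =>
    simp only [simTerm, simState]
    split_ifs with h <;> simp [KripkeModel.Sat, h]
  | matching i =>
    simp only [simTerm, simState]
    split_ifs with h <;> simp [KripkeModel.Sat, h, Nat.modEq_one]
  | seen j =>
    simp only [simTerm, simState, clockAddress, Nat.zero_sub, Nat.zero_mod, KripkeModel.below_zero]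
    split_ifs with h <;> simp [KripkeModel.Sat, h]
  | dia Y d =>
    simp [simTerm, simState, KripkeModel.Sat, KripkeModel.Eval, clockAddress,
      KripkeModel.numberedAccBelow]

lemma simState_active : Λ.simState M PROP₁ s t (.matching (Fin.last _)) x ↔
    s.card ≤ t ∧ M.address s x = clockAddress s.card t := by
  simp only [simState, Fin.val_last, Nat.ModEq, clockAddress,
    Nat.mod_eq_of_lt KripkeModel.address_lt, eq_comm]

lemma simState_bit_add_one (i : Fin s.card) :
    Λ.simState M PROP₁ s (t + 1) (.bit i) x ↔
      M.Eval M.plainAcc (Λ.simState M PROP₁ s t) (Λ.simBody s (.bit i)) x := by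
  simp only [simBody, KripkeModel.eval_ite, KripkeModel.Eval, simState, Fin.val_castSucc]
  obtain ⟨-, h⟩ | ⟨-, h, hi⟩ := add_one_sub_cases i t
  · rw [h, testBit_add_one]
    split_ifs with hi <;> simp [hi]
  · simp [h, hi]

lemma simState_carry_add_one (i : Fin (s.card + 1)) :
    Λ.simState M PROP₁ s (t + 1) (.carry i) x ↔
      M.Eval M.plainAcc (Λ.simState M PROP₁ s t) (Λ.simBody s (.carry i)) x := by
  cases i using Fin.cases with
  | zero => simp [simBody, simState, KripkeModel.Eval]
  | succ i =>
    simp only [simState, simBody, KripkeModel.Eval, Fin.cases_succ, Fin.val_succ, Fin.val_castSucc,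
      Nat.add_sub_add_right, two_pow_succ_dvd_add_one_iff]

lemma simState_matching_add_one (i : Fin (s.card + 1)) :
    Λ.simState M PROP₁ s (t + 1) (.matching i) x ↔
      M.Eval M.plainAcc (Λ.simState M PROP₁ s t) (Λ.simBody s (.matching i)) x := by
  cases i using Fin.cases with
  | zero => simp [simBody, simState, KripkeModel.Eval, Nat.modEq_one]
  | succ i =>
    simp only [simState, simBody, KripkeModel.eval_ite, KripkeModel.Eval, Fin.cases_succ,
      Fin.val_succ, Fin.val_castSucc, Nat.add_sub_add_right, modEq_two_pow_succ_iff,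
      ← KripkeModel.testBit_address, add_le_add_iff_right, and_assoc]
    by_cases hbit : (M.address s x).testBit i = true <;> simp [hbit]

lemma below_clockFrontier (hinj : Function.Injective (M.address s)) {j : ℕ} :
    j + 1 ≤ M.below s x (clockFrontier s.card t) ↔
      j + 1 ≤ M.below s x (clockAddress s.card t) ∨ j ≤ M.below s x (clockAddress s.card t) ∧
        ∃ y, M.R x y ∧ s.card ≤ t ∧ M.address s y = clockAddress s.card t := by
  by_cases ht : s.card ≤ t
  · by_cases h : ∃ y, M.R x y ∧ M.address s y = clockAddress s.card t
    · rw [clockFrontier, if_pos ht, KripkeModel.below_add_one_of_exists hinj h]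
      simp only [ht, true_and, h, and_true]
      omega
    · rw [clockFrontier, if_pos ht, KripkeModel.below_add_one_of_not_exists h]
      simp only [ht, true_and, h, and_false, or_false]
  · have haddress : clockAddress s.card t = 0 := by
      rw [clockAddress, Nat.sub_eq_zero_of_le (not_le.1 ht).le, Nat.zero_mod]
    simp only [clockFrontier, ht, haddress, if_false, false_and, and_false, exists_false, or_false]

lemma simState_seen_add_one (hinj : Function.Injective (M.address s)) (j : Fin (Λ.maxIndex + 1)) :
    Λ.simState M PROP₁ s (t + 1) (.seen j) x ↔
      M.Eval M.plainAcc (Λ.simState M PROP₁ s t) (Λ.simBody s (.seen j)) x := by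
  cases j using Fin.cases with
  | zero => simp [simBody, simState, KripkeModel.Eval]
  | succ j =>
    simp only [simBody, KripkeModel.eval_or, KripkeModel.Eval, KripkeModel.plainAcc, tick, active,
      simState_active, Fin.cases_succ]
    simp only [simState, Fin.val_succ, Fin.val_castSucc, Fin.val_last, clockAddress_add_one,
      ← below_clockFrontier hinj]
    split_ifs with htick <;> simp [htick, KripkeModel.below_zero]

lemma exists_numberedAccBelow_clockFrontier (hs : distinguished PROP₁ S = s) {i : ℕ+}
    {E : M.W → Prop} :
    (∃ y, M.numberedAccBelow PROP₁ s (clockFrontier s.card t) i x y ∧ E y) ↔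
      (∃ y, M.numberedAccBelow PROP₁ s (clockAddress s.card t) i x y ∧ E y) ∨
        (i - 1 ≤ M.below s x (clockAddress s.card t) ∧
          ¬ i ≤ M.below s x (clockAddress s.card t)) ∧
        ∃ y, M.R x y ∧ (s.card ≤ t ∧ M.address s y = clockAddress s.card t) ∧ E y := by
  have hpos := i.pos
  simp only [KripkeModel.numberedAccBelow, lt_clockFrontier_iff]
  constructor
  · rintro ⟨y, ⟨hy, hlt | ⟨ht, heq⟩⟩, hE⟩
    · exact .inl ⟨y, ⟨hy, hlt⟩, hE⟩
    · obtain ⟨hR, hi⟩ := (KripkeModel.numberedAcc_iff hs).1 hy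
      rw [heq] at hi
      exact .inr ⟨by omega, y, hR, ⟨ht, heq⟩, hE⟩
  · rintro (⟨y, ⟨hy, hlt⟩, hE⟩ | ⟨hi, y, hR, ⟨ht, heq⟩, hE⟩)
    · exact ⟨y, ⟨hy, .inl hlt⟩, hE⟩
    · refine ⟨y, ⟨(KripkeModel.numberedAcc_iff hs).2 ⟨hR, ?_⟩, .inr ⟨ht, heq⟩⟩, hE⟩
      rw [heq]
      omega

lemma eval_simTrans (hΛ : Λ.IsMPMSC) (hs : distinguished PROP₁ S = s) {Y} {φ : Schema P _ ℕ+}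
    (hφ : φ.diaSubs ⊆ (Λ.body Y).diaSubs) :
    M.Eval M.plainAcc (Λ.simState M PROP₁ s t) (Λ.simTrans s.card Y φ) x ↔
      M.Eval (M.numberedAccBelow PROP₁ s (clockFrontier s.card t))
        (Λ.valuation M (M.numberedAcc PROP₁) (clockRound s.card t)) φ x := by
  refine KripkeModel.eval_translate (fun _ _ => Iff.rfl) fun i ψ hd hψ y => ?_
  have hmd : ψ.md = 0 := Schema.md_eq_zero_of_mem_diaSubs hΛ.md_body_le (hφ hd)
  have hi : (i : ℕ) ≤ Λ.maxIndex := le_maxIndex_of_mem_diaSubs_body (hφ hd)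
  have hval {j : ℕ} (hj : j ≤ Λ.maxIndex) : (Fin.ofNat (Λ.maxIndex + 1) j : ℕ) = j :=
    Nat.mod_eq_of_lt (Nat.lt_succ_of_le hj)
  simp only [dif_pos (hφ hd), KripkeModel.eval_or, KripkeModel.Eval, active, simState_active,
    exists_numberedAccBelow_clockFrontier hs]
  refine or_congr ?_ (and_congr ?_ ?_)
  · exact exists_congr fun z => and_congr_right' (KripkeModel.eval_congr_of_md_eq_zero hmd)
  · simp only [simState, hval hi, hval ((Nat.sub_le _ 1).trans hi)]
  · exact exists_congr fun z => and_congr_right' (and_congr_right' (hψ z))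

lemma simState_orig_add_one (hΛ : Λ.IsMPMSC) (hs : distinguished PROP₁ S = s) (Y) :
    Λ.simState M PROP₁ s (t + 1) (.orig Y) x ↔
      M.Eval M.plainAcc (Λ.simState M PROP₁ s t) (Λ.simBody s (.orig Y)) x := by
  simp only [simBody, KripkeModel.eval_ite, eval_simTrans hΛ hs subset_rfl, tick]
  simp only [simState, KripkeModel.Eval, Fin.val_last, clockRound_add_one]
  split_ifs with htick
  · simp only [htick, true_imp_iff, not_true_eq_false, false_imp_iff, and_true,
      clockFrontier_of_dvd, KripkeModel.numberedAccBelow_two_pow, valuation_add_one, body]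
  · simp only [htick, false_imp_iff, not_false_eq_true, true_imp_iff, true_and, add_zero]

lemma simState_dia_add_one (hΛ : Λ.IsMPMSC) (hs : distinguished PROP₁ S = s) (Y) (d) :
    Λ.simState M PROP₁ s (t + 1) (.dia Y d) x ↔
      M.Eval M.plainAcc (Λ.simState M PROP₁ s t) (Λ.simBody s (.dia Y d)) x := by
  have hd : (Schema.dia d.1.1 d.1.2).diaSubs ⊆ (Λ.body Y).diaSubs := by
    rw [Schema.diaSubs, Schema.diaSubs_eq_empty
      (Schema.md_eq_zero_of_mem_diaSubs hΛ.md_body_le d.2), LawfulSingleton.insert_empty_eq,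
      Finset.singleton_subset_iff]
    exact d.2
  rw [simBody, KripkeModel.Eval, KripkeModel.Eval, eval_simTrans hΛ hs hd, tick]
  simp only [simState, KripkeModel.Eval, Fin.val_last, clockRound_add_one, clockAddress_add_one]
  split_ifs with htick
  · simp [htick, KripkeModel.numberedAccBelow]
  · simp only [htick, not_false_eq_true, true_and, add_zero]

lemma simState_add_one (hΛ : Λ.IsMPMSC) (hs : distinguished PROP₁ S = s)
    (hM : M.HasIdentifiers PROP₁) (z : SimHead Λ s.card) :
    Λ.simState M PROP₁ s (t + 1) z x ↔
      M.Eval M.plainAcc (Λ.simState M PROP₁ s t) (Λ.simBody s z) x := by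
  cases z with
  | orig Y => exact simState_orig_add_one hΛ hs Y
  | bit i => exact simState_bit_add_one i
  | carry i => exact simState_carry_add_one i
  | matching i => exact simState_matching_add_one i
  | seen j => exact simState_seen_add_one (hM.address_injective hs) j
  | dia Y d => exact simState_dia_add_one hΛ hs Y d

variable (PROP₁) in
lemma exists_isSimulation [LinearOrder VAR] [Infinite VAR] (hΛ : Λ.IsMPMSC) (hS : Λ.IsOver S) :
    ∃ (Γ : Program P VAR Unit) (j : {Y // Y ∈ Λ.heads} ↪o {Y // Y ∈ Γ.heads}),
      Γ.IsMSC ∧ Γ.IsOver S ∧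
      Γ.length ≤ 400 * (Λ.maxIndex + (distinguished PROP₁ S).card + Λ.length) ∧
      IsSimulation.{u, v, w} PROP₁ S Λ Γ (clockRound (distinguished PROP₁ S).card) j := by
  set s := distinguished PROP₁ S
  have hsS : s ⊆ S := by classical exact Finset.filter_subset _ _
  let orig : {Y // Y ∈ Λ.heads} ↪ SimHead Λ s.card := ⟨.orig, fun _ _ => SimHead.orig.inj⟩
  obtain ⟨t, e, he⟩ := exists_equiv_extending Λ.heads orig
  let j : {Y // Y ∈ Λ.heads} ↪o {Y // Y ∈ t} :=
    ⟨orig.trans e.toEmbedding, by simp [← Subtype.coe_le_coe, he]⟩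
  refine ⟨ofEquiv e (Λ.simTerm s.card) (Λ.simBody s) (Λ.attention.map orig) (Λ.print.map orig), j,
    isMSC_ofEquiv, isOver_ofEquiv (props_simTerm_subset hS) (props_simBody_subset hS hsS),
    length_ofEquiv_le.trans (sum_length_sim_le hΛ), ?_⟩
  exact
    { attention_eq := Finset.map_map _ _ _
      print_eq := Finset.map_map _ _ _
      valuation_iff := fun S' hS' M hM n Y x =>
        valuation_ofEquiv (fun _ _ => sat_simTerm (PROP₁ := PROP₁) hΛ _)
          (fun _ _ _ => (simState_add_one hΛ hS' hM _).symm) n (.orig Y) x }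

end Program

end ModalSubst

theorem mainTheorem5 :
    ∃ C : ℕ, ∀ (PROP : Type u) [LinearOrder PROP] (PROP₁ : Set PROP)
      (VAR : Type v) [LinearOrder VAR] [Infinite VAR]
      (S : Finset PROP) (Λ : ModalSubst.Program PROP VAR ℕ+),
      Λ.IsMPMSC → Λ.IsOver S →
      ∃ Γ : ModalSubst.Program PROP VAR Unit,
        Γ.IsMSC ∧ Γ.IsOver S ∧
        Γ.length ≤ C * (Λ.maxIndex + (ModalSubst.distinguished PROP₁ S).card + Λ.length) ∧
        ModalSubst.Program.Equivalent.{u, v, w} PROP₁ S Λ Γ ∧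
        ModalSubst.Program.TimeAtMost.{u, v, w} PROP₁ S Λ Γ
          (2 ^ (C * (ModalSubst.distinguished PROP₁ S).card)) := by
  refine ⟨400, fun PROP _ PROP₁ VAR _ _ S Λ hΛ hS => ?_⟩
  obtain ⟨Γ, j, hMSC, hOver, hlength, hsim⟩ :=
    ModalSubst.Program.exists_isSimulation.{u, v, w} PROP₁ hΛ hS
  have hmono := ModalSubst.clockRound_monotone (ModalSubst.distinguished PROP₁ S).card
  refine ⟨Γ, hMSC, hOver, hlength, hsim.equivalent hmono (ModalSubst.clockRound_surjective _),
    hsim.timeAtMost hmono fun n => ?_⟩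
  obtain ⟨t, ht, hround⟩ := ModalSubst.exists_le_clockRound_eq _ n
  exact ⟨t, ht.trans (Nat.mul_le_mul_right _ (Nat.pow_le_pow_right two_pos (by omega))), hround⟩
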